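/- Let $T:M_n(\mathbb C)\to M_n(\mathbb C)$ be a quantum channel, i.e. $T(X)=\sum_{i=1}^k A_iXA_i^*$ for some $A_i\in M_n(\mathbb C)$, with $\operatorname{Tr}T(X)=\operatorname{Tr}X$ for all $X$. Assume that $T$ is irreducible: the only orthogonal projections $R\in M_n(\mathbb C)$ with $T(RM_nR)\subseteq RM_nR$ are $0$ and $I$. Let $V\neq\{0\}$ be a subspace of $\mathbb C^n$, $P$ the orthogonal projection onto $V$, $Q=I-P$, $\mathbb P X=PXP$, $\mathbb Q X=QXQ$, let $\phi\in V^\perp$ be a unit vector and $\rho_\phi=|\phi\rangle\langle\phi|$. Put $\pi_r=\operatorname{Tr}(\mathbb PT(\mathbb QT)^{r-1}\rho_\phi)$, and define the mean hitting time $\tau(\phi\to V)$ to be $\infty$ if $\sum_{r\ge1}\pi_r<1$ and $\sum_{r\ge1}r\pi_r$ otherwise. Let $$\Phi=\Lambda_{T,V}=\begin{bmatrix}(I-\mathbb Q)T&(I-\mathbb Q)T\\ \mathbb QT&\mathbb QT\end{bmatrix}$$ act on pairs $X=(X_1,X_2)$ of matrices in $M_n(\mathbb C)$, and write $\langle e_I|X\rangle=\operatorname{Tr}X_1+\operatorname{Tr}X_2$.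 For $i=1,2$ let $\mathbb P_i$ be the projector onto the $i$-th component, $\mathbb Q_i=I-\mathbb P_i$, and let $K=(K_{ij})$ be the matrix of mean hitting time operators $$K_{ij}=\sum_{r\ge1}r\,[\Phi(\mathbb Q_i\Phi)^{r-1}]_{ij}.$$ For a $2\times2$ matrix $A$ of linear maps on $M_n(\mathbb C)$ let $A_d=\operatorname{diag}(A_{11},A_{22})$. Put $D=K_d$, and let $E$ be the block matrix all of whose blocks are the identity. (Only the block $K_{11}$ of $D$ enters the formulae below.) Then the series defining $K_{11}$ and $K_{12}$ converge, $\Phi$ has exactly one fixed vector $\pi$ with $\langle e_I|\pi\rangle=1$, and $\tau(\phi\to V)<\infty$. Let $\Omega=|\pi\rangle\langle e_I|$ be the fixed map of $\Phi$. Moreover: (a) For every g-inverse $G$ of $I-\Phi$, that is, every $G$ with $(I-\Phi)G(I-\Phi)=I-\Phi$, $$\tau(\phi\to V)=\operatorname{Tr}\Big(\big[D(\Omega G-(\Omega G)_dE+I-G+G_dE)\big]_{12}\,\rho_\phi\Big).$$ (b) For all pairs $|u\rangle,|f\rangle$ of matrices in $M_n(\mathbb C)$ with $\langle e_I|u\rangle\neq0$,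 the map $I-\Phi+|u\rangle\langle e_I|$ is invertible, $G=(I-\Phi+|u\rangle\langle e_I|)^{-1}+|f\rangle\langle e_I|$ is a g-inverse of $I-\Phi$, and $$\tau(\phi\to V)=\operatorname{Tr}\Big(\big[D(I-G+G_dE)\big]_{12}\,\rho_\phi\Big).$$ -/

import Mathlib

open scoped ENNReal

noncomputable section

/-- The algebra `M_n` of complex `n × n` matrices. -/
abbrev Mat (n : ℕ) : Type := Matrix (Fin n) (Fin n) ℂ

/-- Linear maps `M_n → M_n`. -/
abbrev SuperOp (n : ℕ) : Type := Module.End ℂ (Mat n)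

/-- The pure state Hilbert space `ℂⁿ`. -/
abbrev PureSpace (n : ℕ) : Type := EuclideanSpace ℂ (Fin n)

/-- The two-sided compression `X ↦ A X A`. -/
def compress {n : ℕ} (A : Mat n) : SuperOp n :=
  LinearMap.mulLeft ℂ A * LinearMap.mulRight ℂ A

/-- A quantum channel: a completely positive (Kraus form), trace preserving map. -/
def IsQuantumChannel {n : ℕ} (T : SuperOp n) : Prop :=
  (∃ (k : ℕ) (A : Fin k → Mat n), ∀ X : Mat n, T X = ∑ i, A i * X * (A i).conjTranspose) ∧
    ∀ X : Mat n, (T X).trace = X.trace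

/-- Irreducibility: the only orthogonal projections `P` with `T (P M_n P) ⊆ P M_n P`
are `0` and `1`. -/
def IsIrreducibleMap {n : ℕ} (T : SuperOp n) : Prop :=
  ∀ P : Mat n, P.IsHermitian → P * P = P →
    (∀ X : Mat n, ∃ Y : Mat n, T (P * X * P) = P * Y * P) → P = 0 ∨ P = 1

/-- The matrix of the orthogonal projection onto the subspace `V`. -/
def projMat {n : ℕ} (V : Submodule ℂ (PureSpace n)) : Mat n :=
  (Matrix.toEuclideanCLM (n := Fin n) (𝕜 := ℂ)).symm V.starProjection

/-- The map `X ↦ P X P`, with `P` the orthogonal projection onto `V`. -/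
def superP {n : ℕ} (V : Submodule ℂ (PureSpace n)) : SuperOp n :=
  compress (projMat V)

/-- The map `X ↦ Q X Q`, with `Q = 1 - P`. -/
def superQ {n : ℕ} (V : Submodule ℂ (PureSpace n)) : SuperOp n :=
  compress (1 - projMat V)

/-- The rank one matrix `|φ⟩⟨φ|`. -/
def pureState {n : ℕ} (φ : PureSpace n) : Mat n :=
  Matrix.vecMulVec (fun i => φ i) (fun i => star (φ i))

/-- The probability of reaching `V` for the first time in `r + 1` steps, starting at `φ`.
The trace is a nonnegative real number when `T` is a positive map. -/
def firstVisitProb {n : ℕ} (T : SuperOp n) (V : Submodule ℂ (PureSpace n))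
    (φ : PureSpace n) (r : ℕ) : ℝ≥0∞ :=
  ENNReal.ofReal ((superP V * T * (superQ V * T) ^ r) (pureState φ)).trace.re

/-- The probability of ever reaching `V`, starting at `φ`. -/
def hittingProb {n : ℕ} (T : SuperOp n) (V : Submodule ℂ (PureSpace n))
    (φ : PureSpace n) : ℝ≥0∞ :=
  ∑' r : ℕ, firstVisitProb T V φ r

open Classical in
/-- The mean hitting time `τ(φ → V)`. -/
def meanHittingTime {n : ℕ} (T : SuperOp n) (V : Submodule ℂ (PureSpace n))
    (φ : PureSpace n) : ℝ≥0∞ :=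
  if hittingProb T V φ < 1 then ∞ else ∑' r : ℕ, ((r + 1 : ℕ) : ℝ≥0∞) * firstVisitProb T V φ r

/-- `2 × 2` matrices whose entries are linear maps `M_n → M_n`. -/
abbrev BlockOp (n : ℕ) : Type := Matrix (Fin 2) (Fin 2) (SuperOp n)

/-- The action of a matrix of operators on a column of matrices. -/
def BlockOp.act {n : ℕ} (Φ : BlockOp n) (ρ : Fin 2 → Mat n) : Fin 2 → Mat n :=
  fun i => ∑ j, Φ i j (ρ j)

/-- The chain `Λ_{T,V}` induced by `T` and `V`; index `0` is the site of `V`, index `1` the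
site of its orthogonal complement. -/
def inducedQMC {n : ℕ} (T : SuperOp n) (V : Submodule ℂ (PureSpace n)) : BlockOp n :=
  !![(1 - superQ V) * T, (1 - superQ V) * T;
     superQ V * T, superQ V * T]

/-- The functional `⟨e_I| ρ⟩ = ∑ᵢ Tr ρᵢ`. -/
def totalTrace {n : ℕ} (ρ : Fin 2 → Mat n) : ℂ := ∑ i, (ρ i).trace

/-- The operator `|u⟩⟨e_I|`, that is, `ρ ↦ (∑ⱼ Tr ρⱼ) u`. -/
def ketTrace {n : ℕ} (u : Fin 2 → Mat n) : BlockOp n :=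
  fun i _ => (Matrix.traceLinearMap (Fin n) ℂ ℂ).smulRight (u i)

/-- The block diagonal part `A_d`. -/
def blockDiagPart {n : ℕ} (A : BlockOp n) : BlockOp n :=
  Matrix.diagonal fun i => A i i

/-- The block matrix `E`, all of whose blocks are the identity. -/
def blockE (n : ℕ) : BlockOp n := fun _ _ => 1

/-- The projector onto site `i`. -/
def siteProj (n : ℕ) (i : Fin 2) : BlockOp n := Matrix.diagonal (Pi.single i 1)

/-- The map `Φ (ℚᵢ Φ)^r`, where `ℚᵢ = 1 - ℙᵢ`: site `i` is not visited during the first `r`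
steps, and one more step is made. -/
def monitoredStep {n : ℕ} (Φ : BlockOp n) (i : Fin 2) (r : ℕ) : BlockOp n :=
  Φ * ((1 - siteProj n i) * Φ) ^ r

/-- The sum of a series of linear maps: the linear map whose value at every matrix unit is the
sum of the series of values there. -/
def opSum {n : ℕ} (a : ℕ → SuperOp n) : SuperOp n :=
  (Matrix.stdBasis ℂ (Fin n) (Fin n)).constr ℂ fun p =>
    ∑' r : ℕ, a r (Matrix.stdBasis ℂ (Fin n) (Fin n) p)

/-- The matrix of mean hitting time operators, `K_{ij} = ∑_{r ≥ 1} r [Φ (ℚᵢ Φ)^{r-1}]_{ij}`. -/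
def hittingTimeOp {n : ℕ} (Φ : BlockOp n) : BlockOp n :=
  fun i j => opSum fun r => ((r + 1 : ℕ) : ℂ) • monitoredStep Φ i r i j

/-- `π` is a fixed vector of `Φ` of total trace one. -/
def IsStationaryVec {n : ℕ} (Φ : BlockOp n) (π : Fin 2 → Mat n) : Prop :=
  Φ.act π = π ∧ totalTrace π = 1

/-- `G` is a g-inverse of `A`. -/
def IsGInverse {n : ℕ} (A G : BlockOp n) : Prop := A * G * A = A

end

/-!
Write `𝒫 = superP V`, `𝒬 = superQ V`, `Φ = inducedQMC T V`. Blocks are numbered `1, 2` here; these are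
the indices `0, 1` of `Fin 2`.

*Convergence.* For a vector `v`, the numbers `Tr (𝒬T)^r |v⟩⟨v|` decrease from `‖v‖²`. If they stay
equal to `‖v‖²` for ever, then so they do for every `A i v` (`A i` the Kraus operators), and `A i v`
lies in `Vᗮ`. Such vectors `A i v` span a subspace of `Vᗮ` which is invariant under the Kraus
operators, hence zero by irreducibility, and then `v = 0` because `∑ ‖A i v‖² = ‖v‖²`. By
compactness of the unit sphere some power `(𝒬T)^m` shrinks the trace of all positive semidefinite
matrices by a fixed factor `c < 1`, so the powers of `𝒬T` decay geometrically
(`summable_smul_pow_superQ_mul`). In the first block row, `Φ (ℚΦ)^r` is `(1 - 𝒬) T (𝒬T)^r`, and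
under the trace `1 - 𝒬` equals `𝒫`. Hence the series for `K₁₁ = K₁₂` converges, `V` is reached with
certainty by telescoping (`hittingProb_eq_one`), and `τ = Tr K₁₁ ρ_φ` (`meanHittingTime_eq`).

*Fixed vectors.* A Hermitian fixed point `X = Y - Z` of `T`, split into its positive and negative
part, satisfies `𝒬T Y ≥ Y` for the compression `𝒬` to the support of `Y`. The decay just proved,
applied to the kernel of `Y` in the place of `V`, shows that `Y = 0` unless `Y` has full support and
`Z = 0`. So fixed points of trace zero vanish (`eq_zero_of_fixed`). The same follows for `Φ`, since a
fixed vector of `Φ` is determined by the sum of its components, a fixed point of `T`. A fixed vector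
of total trace one exists since `1 - T` is not surjective.

*The formulae.* The column `z = (-X, X)` satisfies `Φ z = 0`, so `(1 - Φ) z = z`, and any g-inverse
`G` of `1 - Φ` gives `(1 - Φ) G z = z`. Hence `G z - z` is fixed by `Φ`, that is, `G z = z + t π` with
`t = ⟨e_I|G z⟩` (`gInverse_act_eq`). The first component of `G z` is `(G₁₂ - G₁₁) X`, and that of
`Ω G z` is the one of `t π`. So the `(1, 2)` block of `Ω G - (Ω G)_d E + 1 - G + G_d E` is the
identity map, and so is that of `1 - G + G_d E` when `t = 0`, as it is for the generalized inverses
built from `(1 - Φ + |u⟩⟨e_I|)⁻¹`. Both right-hand sides thus reduce to `Tr K₁₁ ρ_φ = τ`.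
-/

noncomputable section

open scoped ComplexOrder
open Matrix Filter Topology

/-! ### Projections, compressions and channels -/

/-- The operator on `ℂⁿ` given by a matrix. -/
abbrev toOp {n : ℕ} (A : Mat n) : PureSpace n →L[ℂ] PureSpace n :=
  Matrix.toEuclideanCLM (n := Fin n) (𝕜 := ℂ) A

lemma compress_apply {n : ℕ} (A X : Mat n) : compress A X = A * X * A := by
  simp [compress, mul_assoc]

lemma toOp_projMat {n : ℕ} (V : Submodule ℂ (PureSpace n)) :
    toOp (projMat V) = V.starProjection :=
  StarAlgEquiv.apply_symm_apply _ _

lemma projMat_isHermitian {n : ℕ} (V : Submodule ℂ (PureSpace n)) : (projMat V).IsHermitian := by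
  have h : IsSelfAdjoint V.starProjection := isSelfAdjoint_starProjection V
  have h2 := (Matrix.toEuclideanCLM (n := Fin n) (𝕜 := ℂ)).symm.map_star' V.starProjection
  rw [h.star_eq] at h2
  exact h2.symm

lemma projMat_mul_self {n : ℕ} (V : Submodule ℂ (PureSpace n)) :
    projMat V * projMat V = projMat V := by
  rw [projMat, ← map_mul, (Submodule.isIdempotentElem_starProjection V).eq]

lemma toOp_one_sub_projMat {n : ℕ} (V : Submodule ℂ (PureSpace n)) :
    toOp (1 - projMat V) = Vᗮ.starProjection := by
  rw [toOp, map_sub, map_one, ← toOp, toOp_projMat, Submodule.starProjection_orthogonal']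

lemma one_sub_projMat_isHermitian {n : ℕ} (V : Submodule ℂ (PureSpace n)) :
    (1 - projMat V).IsHermitian :=
  Matrix.isHermitian_one.sub (projMat_isHermitian V)

lemma one_sub_projMat_mul_self {n : ℕ} (V : Submodule ℂ (PureSpace n)) :
    (1 - projMat V) * (1 - projMat V) = 1 - projMat V := by
  simp [sub_mul, mul_sub, projMat_mul_self]

/-- Since `P² = P` and `Q² = Q`, cyclicity of the trace gives `Tr PXP = Tr X - Tr QXQ`, although
`X ↦ PXP` is not the complement of `X ↦ QXQ`. -/
lemma trace_superP {n : ℕ} (V : Submodule ℂ (PureSpace n)) (X : Mat n) :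
    (superP V X).trace = X.trace - (superQ V X).trace := by
  rw [superP, superQ, compress_apply, compress_apply, Matrix.trace_mul_cycle,
    Matrix.trace_mul_cycle (1 - projMat V), projMat_mul_self, one_sub_projMat_mul_self]
  simp [sub_mul]

lemma compress_posSemidef {n : ℕ} {A X : Mat n} (hA : A.IsHermitian) (hX : X.PosSemidef) :
    (compress A X).PosSemidef := by
  rw [compress_apply]
  simpa only [hA.eq] using hX.mul_mul_conjTranspose_same A

lemma superP_posSemidef {n : ℕ} (V : Submodule ℂ (PureSpace n)) {X : Mat n}
    (hX : X.PosSemidef) : (superP V X).PosSemidef :=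
  compress_posSemidef (projMat_isHermitian V) hX

lemma superQ_posSemidef {n : ℕ} (V : Submodule ℂ (PureSpace n)) {X : Mat n}
    (hX : X.PosSemidef) : (superQ V X).PosSemidef :=
  compress_posSemidef (one_sub_projMat_isHermitian V) hX

lemma IsQuantumChannel.posSemidef {n : ℕ} {T : SuperOp n} (hT : IsQuantumChannel T) {X : Mat n}
    (hX : X.PosSemidef) : (T X).PosSemidef := by
  obtain ⟨⟨k, A, hA⟩, -⟩ := hT
  rw [hA]
  exact Matrix.posSemidef_sum _ fun i _ => hX.mul_mul_conjTranspose_same (A i)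

lemma pow_superQ_mul_posSemidef {n : ℕ} {T : SuperOp n} (hT : IsQuantumChannel T)
    (V : Submodule ℂ (PureSpace n)) (r : ℕ) {X : Mat n} (hX : X.PosSemidef) :
    (((superQ V * T) ^ r) X).PosSemidef := by
  induction r with
  | zero => simpa using hX
  | succ r ih =>
    rw [pow_succ', Module.End.mul_apply, Module.End.mul_apply]
    exact superQ_posSemidef V (hT.posSemidef ih)

lemma pureState_posSemidef {n : ℕ} (v : PureSpace n) : (pureState v).PosSemidef :=
  Matrix.posSemidef_vecMulVec_self_star _

lemma trace_pureState {n : ℕ} (v : PureSpace n) : (pureState v).trace = ((‖v‖ ^ 2 : ℝ) : ℂ) := by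
  rw [pureState, Matrix.trace_vecMulVec, EuclideanSpace.norm_sq_eq]
  push_cast
  simp only [dotProduct]
  refine Finset.sum_congr rfl fun i _ => ?_
  rw [Complex.star_def, Complex.mul_conj, Complex.normSq_eq_norm_sq]
  push_cast
  rfl

lemma mul_pureState_mul_conjTranspose {n : ℕ} (A : Mat n) (v : PureSpace n) :
    A * pureState v * A.conjTranspose = pureState (toOp A v) := by
  have h : (fun i => star (toOp A v i)) = (fun i => star (v i)) ᵥ* Aᴴ := by
    have := Matrix.star_mulVec A v.ofLp
    exact this
  rw [pureState, pureState, h, Matrix.mul_vecMulVec, Matrix.vecMulVec_mul]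
  rfl

lemma superQ_pureState {n : ℕ} (V : Submodule ℂ (PureSpace n)) (v : PureSpace n) :
    superQ V (pureState v) = pureState (Vᗮ.starProjection v) := by
  rw [superQ, compress_apply, ← toOp_one_sub_projMat, ← mul_pureState_mul_conjTranspose,
    (one_sub_projMat_isHermitian V).eq]

lemma trace_superQ_le {n : ℕ} (V : Submodule ℂ (PureSpace n)) {X : Mat n} (hX : X.PosSemidef) :
    (superQ V X).trace.re ≤ X.trace.re := by
  have h := (Complex.nonneg_iff.1 (superP_posSemidef V hX).trace_nonneg).1
  rw [trace_superP, Complex.sub_re] at h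
  linarith

/-- The trace of `(𝒬T)^r X` does not increase with `r`. -/
lemma trace_pow_superQ_mul_antitone {n : ℕ} {T : SuperOp n} (hT : IsQuantumChannel T)
    (V : Submodule ℂ (PureSpace n)) {X : Mat n} (hX : X.PosSemidef) :
    Antitone fun r : ℕ => (((superQ V * T) ^ r) X).trace.re := by
  refine antitone_nat_of_succ_le fun r => ?_
  have hr := pow_superQ_mul_posSemidef hT V r hX
  rw [pow_succ', Module.End.mul_apply, Module.End.mul_apply, ← hT.2 (((superQ V * T) ^ r) X)]
  exact trace_superQ_le V (hT.posSemidef hr)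

/-- A subspace invariant under all Kraus operators of an irreducible map is trivial. -/
lemma IsIrreducibleMap.eq_bot_or_eq_top {n : ℕ} {T : SuperOp n} (hirr : IsIrreducibleMap T)
    {k : ℕ} {A : Fin k → Mat n} (hA : ∀ X : Mat n, T X = ∑ i, A i * X * (A i).conjTranspose)
    (W : Submodule ℂ (PureSpace n)) (hW : ∀ i, ∀ x ∈ W, toOp (A i) x ∈ W) : W = ⊥ ∨ W = ⊤ := by
  have hcomm : ∀ i, projMat W * (A i * projMat W) = A i * projMat W := fun i => by
    refine EquivLike.injective (Matrix.toEuclideanCLM (n := Fin n) (𝕜 := ℂ)) ?_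
    ext1 x
    have hP := toOp_projMat W
    rw [toOp] at hP
    simp only [map_mul, hP, mul_apply_eq_comp]
    exact Submodule.starProjection_eq_self_iff.2 (hW i _ (W.starProjection_apply_mem x))
  have hP := (projMat_isHermitian W).eq
  have hinv : ∀ X : Mat n, ∃ Y : Mat n, T (projMat W * X * projMat W) =
      projMat W * Y * projMat W := fun X => by
    refine ⟨T (projMat W * X * projMat W), ?_⟩
    rw [hA, Finset.mul_sum, Finset.sum_mul]
    refine Finset.sum_congr rfl fun i _ => ?_
    have h1 : projMat W * (A i)ᴴ * projMat W = projMat W * (A i)ᴴ := by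
      have := congrArg conjTranspose (hcomm i)
      simpa only [conjTranspose_mul, hP] using this
    calc A i * (projMat W * X * projMat W) * (A i)ᴴ
        = (A i * projMat W) * X * (projMat W * (A i)ᴴ) := by simp only [mul_assoc]
      _ = (projMat W * (A i * projMat W)) * X * (projMat W * (A i)ᴴ * projMat W) := by
        rw [hcomm, h1]
      _ = _ := by simp only [mul_assoc]
  rcases hirr (projMat W) (projMat_isHermitian W) (projMat_mul_self W) hinv with h | h
  · left
    have h2 := toOp_projMat W
    rw [h, toOp, map_zero] at h2
    rw [← W.range_starProjection, ← h2]
    exact LinearMap.range_zero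
  · right
    have h2 := toOp_projMat W
    rw [h, toOp, map_one] at h2
    rw [← W.range_starProjection, ← h2]
    exact LinearMap.range_id

/-! ### Geometric decay of the monitored evolution -/

/-- The (unnormalised) probability that `V` is not found at any of the times `1, …, r`, starting
at the vector `v`. -/
def survivalProb {n : ℕ} (T : SuperOp n) (V : Submodule ℂ (PureSpace n)) (r : ℕ)
    (v : PureSpace n) : ℝ :=
  (((superQ V * T) ^ r) (pureState v)).trace.re

lemma survivalProb_zero {n : ℕ} (T : SuperOp n) (V : Submodule ℂ (PureSpace n))
    (v : PureSpace n) : survivalProb T V 0 v = ‖v‖ ^ 2 := by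
  rw [survivalProb, pow_zero, Module.End.one_apply, trace_pureState, Complex.ofReal_re]

lemma survivalProb_antitone {n : ℕ} {T : SuperOp n} (hT : IsQuantumChannel T)
    (V : Submodule ℂ (PureSpace n)) (v : PureSpace n) :
    Antitone fun r => survivalProb T V r v :=
  trace_pow_superQ_mul_antitone hT V (pureState_posSemidef v)

lemma survivalProb_le {n : ℕ} {T : SuperOp n} (hT : IsQuantumChannel T)
    (V : Submodule ℂ (PureSpace n)) (r : ℕ) (v : PureSpace n) :
    survivalProb T V r v ≤ ‖v‖ ^ 2 :=
  survivalProb_zero T V v ▸ survivalProb_antitone hT V v r.zero_le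

lemma kraus_pureState {n : ℕ} {T : SuperOp n} {k : ℕ} {A : Fin k → Mat n}
    (hA : ∀ X : Mat n, T X = ∑ i, A i * X * (A i).conjTranspose) (v : PureSpace n) :
    T (pureState v) = ∑ i, pureState (toOp (A i) v) := by
  simp only [hA, mul_pureState_mul_conjTranspose]

lemma survivalProb_succ {n : ℕ} {T : SuperOp n} {k : ℕ} {A : Fin k → Mat n}
    (hA : ∀ X : Mat n, T X = ∑ i, A i * X * (A i).conjTranspose) (V : Submodule ℂ (PureSpace n))
    (r : ℕ) (v : PureSpace n) :
    survivalProb T V (r + 1) v =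
      ∑ i, survivalProb T V r (Vᗮ.starProjection (toOp (A i) v)) := by
  simp only [survivalProb, pow_succ, Module.End.mul_apply, kraus_pureState hA, map_sum,
    superQ_pureState, Matrix.trace_sum, Complex.re_sum]

lemma sum_norm_sq_kraus {n : ℕ} {T : SuperOp n} (hT : IsQuantumChannel T) {k : ℕ}
    {A : Fin k → Mat n} (hA : ∀ X : Mat n, T X = ∑ i, A i * X * (A i).conjTranspose)
    (v : PureSpace n) : ∑ i, ‖toOp (A i) v‖ ^ 2 = ‖v‖ ^ 2 := by
  have h := hT.2 (pureState v)
  simp only [kraus_pureState hA, Matrix.trace_sum, trace_pureState] at h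
  exact_mod_cast h

/-- If `V` is surely never found starting at `v`, then the same holds starting at every `A i v`,
and every `A i v` is orthogonal to `V`. -/
lemma survivalProb_eq_kraus {n : ℕ} {T : SuperOp n} (hT : IsQuantumChannel T) {k : ℕ}
    {A : Fin k → Mat n} (hA : ∀ X : Mat n, T X = ∑ i, A i * X * (A i).conjTranspose)
    {V : Submodule ℂ (PureSpace n)} {v : PureSpace n}
    (hv : ∀ r, survivalProb T V r v = ‖v‖ ^ 2) (i : Fin k) :
    toOp (A i) v ∈ Vᗮ ∧ ∀ r, survivalProb T V r (toOp (A i) v) = ‖toOp (A i) v‖ ^ 2 := by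
  have hproj : ∀ j, ‖Vᗮ.starProjection (toOp (A j) v)‖ ^ 2 ≤ ‖toOp (A j) v‖ ^ 2 := fun j =>
    pow_le_pow_left₀ (norm_nonneg _) (Vᗮ.norm_starProjection_apply_le _) 2
  have key : ∀ r, survivalProb T V r (Vᗮ.starProjection (toOp (A i) v)) =
      ‖toOp (A i) v‖ ^ 2 := fun r => by
    have h := hv (r + 1)
    rw [survivalProb_succ hA, ← sum_norm_sq_kraus hT hA] at h
    exact (Finset.sum_eq_sum_iff_of_le fun j _ =>
      (survivalProb_le hT V r _).trans (hproj j)).1 h i (Finset.mem_univ i)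
  have hmem : toOp (A i) v ∈ Vᗮ := by
    rw [Submodule.mem_iff_norm_starProjection]
    have h0 := key 0
    rw [survivalProb_zero] at h0
    exact ((sq_eq_sq₀ (norm_nonneg _) (norm_nonneg _)).1 h0)
  refine ⟨hmem, fun r => ?_⟩
  have h := key r
  rwa [Submodule.starProjection_eq_self_iff.2 hmem] at h

/-- The vectors reached from sure survivors span an invariant subspace of `Vᗮ ≠ ⊤`, so by
irreducibility there are no sure survivors apart from zero. -/
lemma exists_survivalProb_lt {n : ℕ} {T : SuperOp n} (hT : IsQuantumChannel T)
    (hirr : IsIrreducibleMap T) {V : Submodule ℂ (PureSpace n)} (hV : V ≠ ⊥) {v : PureSpace n}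
    (hv : v ≠ 0) : ∃ r, survivalProb T V r v < ‖v‖ ^ 2 := by
  by_contra! hcon
  have hS : ∀ r, survivalProb T V r v = ‖v‖ ^ 2 := fun r =>
    le_antisymm (survivalProb_le hT V r v) (hcon r)
  obtain ⟨k, A, hA⟩ := hT.1
  set S : Set (PureSpace n) := {x | ∃ w i, (∀ r, survivalProb T V r w = ‖w‖ ^ 2) ∧
    toOp (A i) w = x}
  have hSV : Submodule.span ℂ S ≤ Vᗮ := by
    rw [Submodule.span_le]
    rintro _ ⟨w, i, hw, rfl⟩
    exact (survivalProb_eq_kraus hT hA hw i).1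
  have hinv : ∀ i, ∀ x ∈ Submodule.span ℂ S, toOp (A i) x ∈ Submodule.span ℂ S := by
    intro i
    change Submodule.span ℂ S ≤ (Submodule.span ℂ S).comap (toOp (A i)).toLinearMap
    rw [Submodule.span_le]
    rintro _ ⟨w, j, hw, rfl⟩
    exact Submodule.subset_span ⟨_, i, (survivalProb_eq_kraus hT hA hw j).2, rfl⟩
  rcases hirr.eq_bot_or_eq_top hA _ hinv with h | h
  · have h0 : ∀ i, toOp (A i) v = 0 := fun i => by
      have : toOp (A i) v ∈ Submodule.span ℂ S := Submodule.subset_span ⟨v, i, hS, rfl⟩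
      rwa [h, Submodule.mem_bot] at this
    have h1 := sum_norm_sq_kraus hT hA v
    simp only [h0, norm_zero, ne_eq, OfNat.ofNat_ne_zero, not_false_eq_true, zero_pow,
      Finset.sum_const_zero] at h1
    exact hv (norm_eq_zero.1 (pow_eq_zero_iff two_ne_zero |>.1 h1.symm))
  · rw [h, top_le_iff, Submodule.orthogonal_eq_top_iff] at hSV
    exact hV hSV

lemma continuous_survivalProb {n : ℕ} (T : SuperOp n) (V : Submodule ℂ (PureSpace n)) (r : ℕ) :
    Continuous (survivalProb T V r) := by
  have h1 : Continuous fun v : PureSpace n => pureState v := by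
    unfold pureState
    fun_prop
  have h2 : Continuous fun X : Mat n => (((superQ V * T) ^ r) X).trace :=
    ((Matrix.traceLinearMap (Fin n) ℂ ℂ) ∘ₗ ((superQ V * T) ^ r)).continuous_of_finiteDimensional
  exact Complex.continuous_re.comp (h2.comp h1)

lemma survivalProb_smul {n : ℕ} (T : SuperOp n) (V : Submodule ℂ (PureSpace n)) (r : ℕ) (a : ℝ)
    (v : PureSpace n) : survivalProb T V r ((a : ℂ) • v) = a ^ 2 * survivalProb T V r v := by
  have h : pureState ((a : ℂ) • v) = ((a ^ 2 : ℝ) : ℂ) • pureState v := by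
    ext i j
    simp [pureState, Matrix.vecMulVec_apply]
    ring
  rw [survivalProb, h, map_smul, Matrix.trace_smul, smul_eq_mul, Complex.re_ofReal_mul]
  rfl

/-- By compactness of the unit sphere, the bound of `exists_survivalProb_lt` is uniform. -/
lemma exists_survivalProb_le_mul {n : ℕ} {T : SuperOp n} (hT : IsQuantumChannel T)
    (hirr : IsIrreducibleMap T) {V : Submodule ℂ (PureSpace n)} (hV : V ≠ ⊥) :
    ∃ m : ℕ, ∃ c : ℝ, 0 < c ∧ c < 1 ∧ ∀ v, survivalProb T V m v ≤ c * ‖v‖ ^ 2 := by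
  have hK := isCompact_sphere (0 : PureSpace n) 1
  obtain ⟨m, hm⟩ := hK.elim_directed_cover (fun r : ℕ => {v | survivalProb T V r v < 1})
    (fun r => isOpen_lt (continuous_survivalProb T V r) continuous_const)
    (fun v hv => by
      have hv1 : ‖v‖ = 1 := by simpa using hv
      obtain ⟨r, hr⟩ := exists_survivalProb_lt hT hirr hV (v := v)
        (norm_ne_zero_iff.1 (by rw [hv1]; exact one_ne_zero))
      rw [hv1, one_pow] at hr
      exact Set.mem_iUnion.2 ⟨r, hr⟩)
    (directed_of_isDirected_le fun r s hrs v hv =>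
      (survivalProb_antitone hT V v hrs).trans_lt hv)
  have hb : ∃ c : ℝ, 0 < c ∧ c < 1 ∧ ∀ v ∈ Metric.sphere (0 : PureSpace n) 1,
      survivalProb T V m v ≤ c := by
    rcases (Metric.sphere (0 : PureSpace n) 1).eq_empty_or_nonempty with he | hne
    · exact ⟨1 / 2, by norm_num, by norm_num, by simp [he]⟩
    · obtain ⟨w, hw, hmax⟩ := hK.exists_isMaxOn hne (continuous_survivalProb T V m).continuousOn
      -- the maximum may vanish, but the rate of decay is an `m`-th root of a positive constant
      exact ⟨max (1 / 2) (survivalProb T V m w), by positivity, max_lt (by norm_num) (hm hw),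
        fun v hv => (hmax hv).trans (le_max_right _ _)⟩
  obtain ⟨c, hc0, hc1, hc⟩ := hb
  refine ⟨m, c, hc0, hc1, fun v => ?_⟩
  rcases eq_or_ne v 0 with rfl | hv
  · simpa using survivalProb_le hT V m 0
  · have hv' := norm_ne_zero_iff.2 hv
    have h := hc (((‖v‖⁻¹ : ℝ) : ℂ) • v) (by simp [norm_smul, hv'])
    rw [survivalProb_smul, inv_pow, inv_mul_le_iff₀ (by positivity)] at h
    linarith

/-- A positive semidefinite matrix is a sum of pure states. -/
lemma exists_eq_sum_pureState {n : ℕ} {X : Mat n} (hX : X.PosSemidef) :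
    ∃ (m : ℕ) (x : Fin m → PureSpace n), X = ∑ k, pureState (x k) := by
  obtain ⟨m, x, hx⟩ := Matrix.posSemidef_iff_eq_sum_vecMulVec.1 hX
  exact ⟨m, fun k => WithLp.toLp 2 (x k), hx⟩

lemma exists_trace_pow_le_mul {n : ℕ} {T : SuperOp n} (hT : IsQuantumChannel T)
    (hirr : IsIrreducibleMap T) {V : Submodule ℂ (PureSpace n)} (hV : V ≠ ⊥) :
    ∃ m : ℕ, ∃ c : ℝ, 0 < c ∧ c < 1 ∧ ∀ X : Mat n, X.PosSemidef →
      (((superQ V * T) ^ m) X).trace.re ≤ c * X.trace.re := by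
  obtain ⟨m, c, hc0, hc1, hc⟩ := exists_survivalProb_le_mul hT hirr hV
  refine ⟨m, c, hc0, hc1, fun X hX => ?_⟩
  obtain ⟨l, x, rfl⟩ := exists_eq_sum_pureState hX
  simp only [map_sum, Matrix.trace_sum, Complex.re_sum, Finset.mul_sum]
  refine Finset.sum_le_sum fun k _ => ?_
  rw [trace_pureState, Complex.ofReal_re]
  exact hc (x k)

/-- A nonnegative nonincreasing sequence which contracts by a fixed factor over `m` steps decays
geometrically. -/
lemma exists_le_mul_pow_of_antitone {a : ℕ → ℝ} (ha : Antitone a) (ha0 : ∀ r, 0 ≤ a r) {m : ℕ}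
    {c : ℝ} (hc0 : 0 < c) (hc1 : c < 1) (hac : ∀ r, a (r + m) ≤ c * a r) :
    ∃ C q : ℝ, 0 ≤ q ∧ q < 1 ∧ ∀ r, a r ≤ C * q ^ r := by
  rcases Nat.eq_zero_or_pos m with rfl | hm
  · refine ⟨0, 0, le_rfl, one_pos, fun r => ?_⟩
    have := hac r
    rw [add_zero] at this
    nlinarith [ha0 r]
  have hm' : (0 : ℝ) < m := by exact_mod_cast hm
  set q := c ^ (1 / m : ℝ) with hq
  have hq0 : 0 < q := Real.rpow_pos_of_pos hc0 _
  have hq1 : q < 1 := Real.rpow_lt_one hc0.le hc1 (by positivity)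
  have hqm : q ^ m = c := by
    rw [hq, ← Real.rpow_natCast, ← Real.rpow_mul hc0.le, one_div, inv_mul_cancel₀ hm'.ne',
      Real.rpow_one]
  refine ⟨a 0 / c, q, hq0.le, hq1, fun r => ?_⟩
  induction r using Nat.strong_induction_on with
  | _ r ih =>
    rcases lt_or_ge r m with hr | hr
    · have h1 : c ≤ q ^ r := hqm ▸ pow_le_pow_of_le_one hq0.le hq1.le hr.le
      calc a r ≤ a 0 := ha r.zero_le
        _ = a 0 / c * c := by field_simp
        _ ≤ a 0 / c * q ^ r := mul_le_mul_of_nonneg_left h1 (div_nonneg (ha0 0) hc0.le)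
    · obtain ⟨s, rfl⟩ := Nat.exists_eq_add_of_le' hr
      calc a (s + m) ≤ c * a s := hac s
        _ ≤ c * (a 0 / c * q ^ s) := mul_le_mul_of_nonneg_left (ih s (by omega)) hc0.le
        _ = a 0 / c * q ^ (s + m) := by rw [pow_add, hqm]; ring

/-- The entries of a positive semidefinite matrix are bounded by its trace. -/
lemma norm_apply_le_trace {n : ℕ} {X : Mat n} (hX : X.PosSemidef) (i j : Fin n) :
    ‖X i j‖ ≤ X.trace.re := by
  obtain ⟨l, x, rfl⟩ := exists_eq_sum_pureState hX
  rw [Matrix.sum_apply, Matrix.trace_sum, Complex.re_sum]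
  refine (norm_sum_le _ _).trans (Finset.sum_le_sum fun k _ => ?_)
  rw [trace_pureState, Complex.ofReal_re, pureState, Matrix.vecMulVec_apply, norm_mul, norm_star,
    sq]
  exact mul_le_mul (PiLp.norm_apply_le (x k) i) (PiLp.norm_apply_le (x k) j) (norm_nonneg _)
    (norm_nonneg _)

/-- The positive and negative parts of a Hermitian matrix. -/
lemma exists_posSemidef_sub {n : ℕ} {X : Mat n} (hX : X.IsHermitian) :
    ∃ Y Z : Mat n, Y.PosSemidef ∧ Z.PosSemidef ∧ X = Y - Z ∧ Y * Z = 0 := by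
  set U : Mat n := (hX.eigenvectorUnitary : Mat n) with hU
  have hUU : Uᴴ * U = 1 := Unitary.coe_star_mul_self hX.eigenvectorUnitary
  have hX' : X = U * diagonal (fun i => (hX.eigenvalues i : ℂ)) * Uᴴ := hX.spectral_theorem
  refine ⟨U * diagonal (fun i => ((max (hX.eigenvalues i) 0 : ℝ) : ℂ)) * Uᴴ,
    U * diagonal (fun i => ((max (-hX.eigenvalues i) 0 : ℝ) : ℂ)) * Uᴴ, ?_, ?_, ?_, ?_⟩
  · refine Matrix.PosSemidef.mul_mul_conjTranspose_same (Matrix.PosSemidef.diagonal fun i => ?_) U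
    exact Complex.zero_le_real.2 (le_max_right _ _)
  · refine Matrix.PosSemidef.mul_mul_conjTranspose_same (Matrix.PosSemidef.diagonal fun i => ?_) U
    exact Complex.zero_le_real.2 (le_max_right _ _)
  · conv_lhs => rw [hX']
    rw [← sub_mul, ← mul_sub, diagonal_sub]
    congr 3
    funext i
    rw [← Complex.ofReal_sub]
    congr 1
    rw [max_zero_sub_max_neg_zero_eq_self]
  · have h : diagonal (fun i => ((max (hX.eigenvalues i) 0 : ℝ) : ℂ)) *
        diagonal (fun i => ((max (-hX.eigenvalues i) 0 : ℝ) : ℂ)) = 0 := by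
      rw [diagonal_mul_diagonal, ← diagonal_zero]
      congr 1
      funext i
      rw [← Complex.ofReal_mul, Complex.ofReal_eq_zero]
      rcases le_total (hX.eigenvalues i) 0 with h | h
      · simp [h]
      · simp [h]
    calc _ = U * (diagonal (fun i => ((max (hX.eigenvalues i) 0 : ℝ) : ℂ)) * (Uᴴ * U) *
        diagonal (fun i => ((max (-hX.eigenvalues i) 0 : ℝ) : ℂ))) * Uᴴ := by
          simp only [mul_assoc]
      _ = 0 := by rw [hUU, mul_one, h]; simp

/-- Every matrix is `H + i H'` with `H` and `H'` Hermitian. -/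
lemma exists_isHermitian_add_I_smul {n : ℕ} (X : Mat n) :
    ∃ H H' : Mat n, H.IsHermitian ∧ H'.IsHermitian ∧ X = H + Complex.I • H' :=
  ⟨realPart X, imaginaryPart X, (realPart X).2, (imaginaryPart X).2,
    (realPart_add_I_smul_imaginaryPart X).symm⟩

/-- A linear property of matrices holds in general if it holds for positive semidefinite ones. -/
lemma submodule_eq_top_of_posSemidef {n : ℕ} {S : Submodule ℂ (Mat n)}
    (hS : ∀ X : Mat n, X.PosSemidef → X ∈ S) : S = ⊤ := by
  have hH : ∀ X : Mat n, X.IsHermitian → X ∈ S := fun X hX => by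
    obtain ⟨Y, Z, hY, hZ, rfl, -⟩ := exists_posSemidef_sub hX
    exact S.sub_mem (hS Y hY) (hS Z hZ)
  refine Submodule.eq_top_iff'.2 fun X => ?_
  obtain ⟨H, H', h, h', rfl⟩ := exists_isHermitian_add_I_smul X
  exact S.add_mem (hH H h) (S.smul_mem _ (hH H' h'))

/-- For an irreducible channel and `V ≠ ⊥`, the powers of `𝒬T` are summable even with linear
weights. -/
lemma summable_smul_pow_superQ_mul {n : ℕ} {T : SuperOp n} (hT : IsQuantumChannel T)
    (hirr : IsIrreducibleMap T) {V : Submodule ℂ (PureSpace n)} (hV : V ≠ ⊥) (X : Mat n) :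
    Summable fun r : ℕ => ((r + 1 : ℕ) : ℂ) • ((superQ V * T) ^ r) X := by
  let S : Submodule ℂ (Mat n) :=
    { carrier := {X | Summable fun r : ℕ => ((r + 1 : ℕ) : ℂ) • ((superQ V * T) ^ r) X}
      zero_mem' := by simp [summable_zero]
      add_mem' := fun {x y} hx hy => by
        simpa only [Set.mem_ofPred_eq, map_add, smul_add] using hx.add hy
      smul_mem' := fun a x hx => by
        simpa only [Set.mem_ofPred_eq, map_smul, smul_comm _ a] using hx.const_smul a }
  suffices hS : S = ⊤ by
    have : X ∈ S := hS ▸ Submodule.mem_top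
    exact this
  refine submodule_eq_top_of_posSemidef fun X hX => ?_
  obtain ⟨m, c, hc0, hc1, hc⟩ := exists_trace_pow_le_mul hT hirr hV
  have hpsd := fun r => pow_superQ_mul_posSemidef hT V r hX
  obtain ⟨C, q, hq0, hq1, hq⟩ := exists_le_mul_pow_of_antitone
    (trace_pow_superQ_mul_antitone hT V hX)
    (fun r => (Complex.nonneg_iff.1 (hpsd r).trace_nonneg).1) hc0 hc1 (m := m) (fun r => by
      rw [add_comm r m, pow_add, Module.End.mul_apply]
      exact hc _ (hpsd r))
  have hq' : ‖q‖ < 1 := by rwa [Real.norm_of_nonneg hq0]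
  have hsum : Summable fun r : ℕ => ((r + 1 : ℕ) : ℝ) * (C * q ^ r) := by
    have h1 := (summable_pow_mul_geometric_of_norm_lt_one 1 hq').add
      (summable_geometric_of_norm_lt_one hq')
    refine (h1.mul_left C).congr fun r => ?_
    push_cast
    ring
  change Summable fun r : ℕ => ((r + 1 : ℕ) : ℂ) • ((superQ V * T) ^ r) X
  refine Pi.summable.2 fun i => Pi.summable.2 fun j => ?_
  refine Summable.of_norm_bounded hsum fun r => ?_
  rw [Matrix.smul_apply, norm_smul, Complex.norm_natCast]
  exact mul_le_mul_of_nonneg_left ((norm_apply_le_trace (hpsd r) i j).trans (hq r))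
    (Nat.cast_nonneg _)

lemma tendsto_pow_superQ_mul {n : ℕ} {T : SuperOp n} (hT : IsQuantumChannel T)
    (hirr : IsIrreducibleMap T) {V : Submodule ℂ (PureSpace n)} (hV : V ≠ ⊥) (X : Mat n) :
    Tendsto (fun r : ℕ => ((superQ V * T) ^ r) X) atTop (𝓝 0) := by
  have h := (summable_smul_pow_superQ_mul hT hirr hV X).tendsto_atTop_zero
  refine tendsto_pi_nhds.2 fun i => tendsto_pi_nhds.2 fun j => ?_
  have hij := tendsto_pi_nhds.1 (tendsto_pi_nhds.1 h i) j
  refine squeeze_zero_norm (fun r => ?_) (tendsto_norm_zero.comp hij)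
  rw [Function.comp_apply, Matrix.smul_apply, norm_smul, Complex.norm_natCast]
  exact le_mul_of_one_le_left (norm_nonneg _) (by exact_mod_cast r.succ_pos)

/-! ### Fixed points of an irreducible channel -/

/-- If `X = Y - Z` is the decomposition of a Hermitian fixed point into its positive and negative
part and `𝒬` is the compression to the support of `Y`, then `𝒬T Y ≥ 𝒬T X = Y`. The powers of `𝒬T`
tend to zero unless `Y` has full support, so `Y = 0` or `Z = 0`. -/
lemma eq_zero_of_isHermitian_of_fixed {n : ℕ} {T : SuperOp n} (hT : IsQuantumChannel T)
    (hirr : IsIrreducibleMap T) {X : Mat n} (hX : X.IsHermitian) (hTX : T X = X)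
    (htr : X.trace = 0) : X = 0 := by
  obtain ⟨Y, Z, hY, hZ, hXYZ, hYZ⟩ := exists_posSemidef_sub hX
  have htrYZ : Y.trace = Z.trace := by
    rw [hXYZ, Matrix.trace_sub] at htr
    exact sub_eq_zero.1 htr
  suffices h : Y.trace = 0 by
    rw [hXYZ, hY.trace_eq_zero_iff.1 h, hZ.trace_eq_zero_iff.1 (htrYZ ▸ h), sub_zero]
  set V : Submodule ℂ (PureSpace n) := LinearMap.ker (toOp Y).toLinearMap
  have hP := toOp_projMat V
  rw [toOp] at hP
  have hYP : Y * projMat V = 0 := by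
    refine EquivLike.injective (Matrix.toEuclideanCLM (n := Fin n) (𝕜 := ℂ)) ?_
    ext1 x
    simp only [map_mul, hP, mul_apply_eq_comp, map_zero]
    exact LinearMap.mem_ker.1 (V.starProjection_apply_mem x)
  have hPZ : projMat V * Z = Z := by
    refine EquivLike.injective (Matrix.toEuclideanCLM (n := Fin n) (𝕜 := ℂ)) ?_
    ext1 x
    simp only [map_mul, hP, mul_apply_eq_comp]
    refine Submodule.starProjection_eq_self_iff.2 (LinearMap.mem_ker.2 ?_)
    change (toOp Y) ((toOp Z) x) = 0
    rw [← mul_apply_eq_comp, toOp, toOp, ← map_mul, hYZ, map_zero]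
    rfl
  by_cases hV : V = ⊥
  · have hZ0 : Z = 0 := by
      rw [← hPZ, projMat, hV, Submodule.starProjection_bot, map_zero, zero_mul]
    rw [htrYZ, hZ0, Matrix.trace_zero]
  · have hPY : projMat V * Y = 0 := by
      have h := congrArg conjTranspose hYP
      rwa [conjTranspose_mul, hY.1.eq, (projMat_isHermitian V).eq, conjTranspose_zero] at h
    have hQY : superQ V Y = Y := by
      rw [superQ, compress_apply, sub_mul, hPY, mul_sub, sub_zero, one_mul, hYP, sub_zero, mul_one]
    have hQZ : superQ V Z = 0 := by
      rw [superQ, compress_apply, sub_mul, hPZ, one_mul, sub_self, zero_mul]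
    have hstep : (superQ V * T) Y = Y + (superQ V * T) Z := by
      have h : (superQ V * T) (Y - Z) = Y := by
        rw [← hXYZ, Module.End.mul_apply, hTX, hXYZ, map_sub, hQY, hQZ, sub_zero]
      rw [map_sub] at h
      exact sub_eq_iff_eq_add.1 h
    have hge : ∀ r : ℕ, Y.trace.re ≤ (((superQ V * T) ^ r) Y).trace.re := fun r => by
      induction r with
      | zero => exact le_rfl
      | succ r ih =>
        have h1 : 0 ≤ (((superQ V * T) ^ (r + 1)) Z).trace.re :=
          (Complex.nonneg_iff.1 (pow_superQ_mul_posSemidef hT V (r + 1) hZ).trace_nonneg).1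
        rw [pow_succ, Module.End.mul_apply] at h1 ⊢
        rw [hstep, map_add, Matrix.trace_add, Complex.add_re]
        linarith
    have hlim : Tendsto (fun r : ℕ => (((superQ V * T) ^ r) Y).trace.re) atTop (𝓝 0) := by
      have hc : Continuous fun X : Mat n => X.trace.re := by fun_prop
      simpa [Function.comp_def] using (hc.tendsto 0).comp (tendsto_pow_superQ_mul hT hirr hV Y)
    have hY0 := Complex.nonneg_iff.1 hY.trace_nonneg
    exact Complex.ext (le_antisymm (ge_of_tendsto' hlim hge) hY0.1) hY0.2.symm

lemma IsQuantumChannel.map_conjTranspose {n : ℕ} {T : SuperOp n} (hT : IsQuantumChannel T)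
    (X : Mat n) : T Xᴴ = (T X)ᴴ := by
  obtain ⟨⟨k, A, hA⟩, -⟩ := hT
  simp only [hA, conjTranspose_sum, conjTranspose_mul, conjTranspose_conjTranspose, mul_assoc]

/-- Real and imaginary part of a fixed point of a channel are fixed points. -/
lemma IsQuantumChannel.exists_isHermitian_fixed {n : ℕ} {T : SuperOp n}
    (hT : IsQuantumChannel T) {X : Mat n} (hX : T X = X) :
    ∃ H H' : Mat n, H.IsHermitian ∧ H'.IsHermitian ∧ T H = H ∧ T H' = H' ∧
      X = H + Complex.I • H' := by
  have hstar : T (star X) = star X := (hT.map_conjTranspose X).trans (congrArg star hX)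
  refine ⟨realPart X, imaginaryPart X, (realPart X).2, (imaginaryPart X).2, ?_, ?_,
    (realPart_add_I_smul_imaginaryPart X).symm⟩
  · rw [realPart_apply_coe, ← Complex.coe_smul, map_smul, map_add, hX, hstar]
  · rw [imaginaryPart_apply_coe, map_smul, ← Complex.coe_smul, map_smul, map_sub, hX, hstar]

/-- A fixed point of trace zero of an irreducible channel vanishes. -/
lemma eq_zero_of_fixed {n : ℕ} {T : SuperOp n} (hT : IsQuantumChannel T)
    (hirr : IsIrreducibleMap T) {X : Mat n} (hX : T X = X) (htr : X.trace = 0) : X = 0 := by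
  obtain ⟨H, H', h, h', hTH, hTH', rfl⟩ := hT.exists_isHermitian_fixed hX
  have him : ∀ {M : Mat n}, M.IsHermitian → M.trace.im = 0 := fun {M} hM => by
    have := Matrix.trace_conjTranspose M
    rw [hM.eq] at this
    exact Complex.conj_eq_iff_im.1 this.symm
  have h1 := him h
  have h2 := him h'
  rw [Matrix.trace_add, Matrix.trace_smul, smul_eq_mul] at htr
  have hre := congrArg Complex.re htr
  have him' := congrArg Complex.im htr
  simp only [Complex.add_re, Complex.mul_re, Complex.I_re, Complex.I_im, zero_mul, one_mul, h2,
    sub_zero, add_zero, Complex.zero_re] at hre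
  simp only [Complex.add_im, Complex.mul_im, Complex.I_re, Complex.I_im, zero_mul, one_mul, h1,
    zero_add, Complex.zero_im] at him'
  rw [eq_zero_of_isHermitian_of_fixed hT hirr h hTH (Complex.ext hre h1),
    eq_zero_of_isHermitian_of_fixed hT hirr h' hTH' (Complex.ext him' h2), smul_zero, add_zero]

lemma exists_fixed_trace_one {n : ℕ} [NeZero n] {T : SuperOp n} (hT : IsQuantumChannel T)
    (hirr : IsIrreducibleMap T) : ∃ X : Mat n, T X = X ∧ X.trace = 1 := by
  -- `1 - T` takes values of trace zero, so it is not surjective and has a kernel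
  have hns : ¬ Function.Surjective (1 - T : SuperOp n) := fun hs => by
    obtain ⟨X, hX⟩ := hs 1
    have h := congrArg Matrix.trace hX
    rw [LinearMap.sub_apply, Module.End.one_apply, Matrix.trace_sub, hT.2, sub_self,
      Matrix.trace_one, Fintype.card_fin] at h
    exact NeZero.ne n (by exact_mod_cast h.symm)
  rw [← LinearMap.injective_iff_surjective, injective_iff_map_eq_zero] at hns
  push Not at hns
  obtain ⟨X, hX, hX0⟩ := hns
  have hTX : T X = X := (sub_eq_zero.1 hX).symm
  have htr : X.trace ≠ 0 := fun h => hX0 (eq_zero_of_fixed hT hirr hTX h)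
  refine ⟨X.trace⁻¹ • X, by rw [map_smul, hTX], ?_⟩
  rw [Matrix.trace_smul, smul_eq_mul, inv_mul_cancel₀ htr]

/-! ### The action of block matrices -/

/-- Block matrices of operators, acting by `BlockOp.act`, are all linear maps on columns. -/
def actEquiv (n : ℕ) : BlockOp n ≃+* Module.End ℂ (Fin 2 → Mat n) :=
  (endVecRingEquivMatrixEnd (Fin 2) ℂ (Mat n)).symm

lemma actEquiv_apply {n : ℕ} (Φ : BlockOp n) (x : Fin 2 → Mat n) :
    actEquiv n Φ x = Φ.act x := rfl

lemma BlockOp.act_mul {n : ℕ} (Φ Ψ : BlockOp n) (x : Fin 2 → Mat n) :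
    BlockOp.act (Φ * Ψ) x = Φ.act (Ψ.act x) := by
  rw [← actEquiv_apply, map_mul]; rfl

lemma BlockOp.act_add {n : ℕ} (Φ Ψ : BlockOp n) (x : Fin 2 → Mat n) :
    BlockOp.act (Φ + Ψ) x = Φ.act x + Ψ.act x := by
  rw [← actEquiv_apply, map_add]; rfl

lemma BlockOp.one_sub_act {n : ℕ} (Φ : BlockOp n) (x : Fin 2 → Mat n) :
    (1 - Φ).act x = x - Φ.act x := by
  rw [← actEquiv_apply, map_sub, map_one]; rfl

lemma BlockOp.act_sub_right {n : ℕ} (Φ : BlockOp n) (x y : Fin 2 → Mat n) :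
    Φ.act (x - y) = Φ.act x - Φ.act y :=
  map_sub (actEquiv n Φ) x y

lemma BlockOp.act_smul_right {n : ℕ} (Φ : BlockOp n) (a : ℂ) (x : Fin 2 → Mat n) :
    Φ.act (a • x) = a • Φ.act x :=
  map_smul (actEquiv n Φ) a x

lemma BlockOp.ext_act {n : ℕ} {Φ Ψ : BlockOp n} (h : ∀ x, Φ.act x = Ψ.act x) : Φ = Ψ :=
  (actEquiv n).injective (LinearMap.ext h)

lemma BlockOp.isUnit_of_act_eq_zero {n : ℕ} {Φ : BlockOp n} (h : ∀ x, Φ.act x = 0 → x = 0) :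
    IsUnit Φ := by
  rw [← MulEquiv.isUnit_map (actEquiv n), LinearMap.isUnit_iff_ker_eq_bot, LinearMap.ker_eq_bot']
  exact h

lemma totalTrace_sub {n : ℕ} (x y : Fin 2 → Mat n) :
    totalTrace (x - y) = totalTrace x - totalTrace y := by
  simp [totalTrace, Matrix.trace_sub]

lemma totalTrace_add {n : ℕ} (x y : Fin 2 → Mat n) :
    totalTrace (x + y) = totalTrace x + totalTrace y := by
  simp [totalTrace, Matrix.trace_add]; ring

lemma totalTrace_smul {n : ℕ} (a : ℂ) (x : Fin 2 → Mat n) :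
    totalTrace (a • x) = a * totalTrace x := by
  simp [totalTrace, Matrix.trace_smul, mul_add]

lemma ketTrace_act {n : ℕ} (u x : Fin 2 → Mat n) :
    (ketTrace u).act x = totalTrace x • u := by
  funext i
  simp [BlockOp.act, ketTrace, totalTrace, add_smul]

/-! ### Fixed vectors and g-inverses for the induced chain -/

lemma inducedQMC_act_zero {n : ℕ} (T : SuperOp n) (V : Submodule ℂ (PureSpace n))
    (x : Fin 2 → Mat n) :
    (inducedQMC T V).act x 0 = T (x 0 + x 1) - superQ V (T (x 0 + x 1)) := by
  simp [BlockOp.act, inducedQMC]; abel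

lemma inducedQMC_act_one {n : ℕ} (T : SuperOp n) (V : Submodule ℂ (PureSpace n))
    (x : Fin 2 → Mat n) :
    (inducedQMC T V).act x 1 = superQ V (T (x 0 + x 1)) := by
  simp [BlockOp.act, inducedQMC]

lemma totalTrace_inducedQMC_act {n : ℕ} {T : SuperOp n} (hT : IsQuantumChannel T)
    (V : Submodule ℂ (PureSpace n)) (x : Fin 2 → Mat n) :
    totalTrace ((inducedQMC T V).act x) = totalTrace x := by
  rw [totalTrace, totalTrace, Fin.sum_univ_two, Fin.sum_univ_two, inducedQMC_act_zero,
    inducedQMC_act_one, ← Matrix.trace_add, sub_add_cancel, hT.2, Matrix.trace_add]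

/-- A fixed vector of the induced chain is determined by the sum of its two components, and this
sum is a fixed point of `T`. -/
lemma eq_zero_of_inducedQMC_fixed {n : ℕ} {T : SuperOp n} (hT : IsQuantumChannel T)
    (hirr : IsIrreducibleMap T) (V : Submodule ℂ (PureSpace n)) {x : Fin 2 → Mat n}
    (hx : (inducedQMC T V).act x = x) (htr : totalTrace x = 0) : x = 0 := by
  have h0 := inducedQMC_act_zero T V x
  have h1 := inducedQMC_act_one T V x
  rw [hx] at h0 h1
  have hfix : T (x 0 + x 1) = x 0 + x 1 := by
    have h2 : x 0 + x 1 = T (x 0 + x 1) - superQ V (T (x 0 + x 1)) +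
        superQ V (T (x 0 + x 1)) := congrArg₂ (· + ·) h0 h1
    rw [sub_add_cancel] at h2
    exact h2.symm
  have hsum : x 0 + x 1 = 0 := eq_zero_of_fixed hT hirr hfix (by
    rwa [totalTrace, Fin.sum_univ_two, ← Matrix.trace_add] at htr)
  rw [hsum, map_zero, map_zero] at h0 h1
  funext i
  fin_cases i
  · simpa using h0
  · exact h1

lemma existsUnique_isStationaryVec {n : ℕ} [NeZero n] {T : SuperOp n} (hT : IsQuantumChannel T)
    (hirr : IsIrreducibleMap T) (V : Submodule ℂ (PureSpace n)) :
    ∃! π : Fin 2 → Mat n, IsStationaryVec (inducedQMC T V) π := by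
  obtain ⟨X, hX, htr⟩ := exists_fixed_trace_one hT hirr
  have hfix : (inducedQMC T V).act ![X - superQ V X, superQ V X] =
      ![X - superQ V X, superQ V X] := by
    funext i
    fin_cases i
    · simpa [hX] using inducedQMC_act_zero T V ![X - superQ V X, superQ V X]
    · simpa [hX] using inducedQMC_act_one T V ![X - superQ V X, superQ V X]
  have hone : totalTrace ![X - superQ V X, superQ V X] = 1 := by simp [totalTrace, htr]
  refine ⟨_, ⟨hfix, hone⟩, fun x hx =>
    sub_eq_zero.1 (eq_zero_of_inducedQMC_fixed hT hirr V ?_ ?_)⟩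
  · rw [BlockOp.act_sub_right, hx.1, hfix]
  · rw [totalTrace_sub, hx.2, hone, sub_self]

lemma eq_totalTrace_smul_of_fixed {n : ℕ} {T : SuperOp n} (hT : IsQuantumChannel T)
    (hirr : IsIrreducibleMap T) {V : Submodule ℂ (PureSpace n)} {π x : Fin 2 → Mat n}
    (hπ : IsStationaryVec (inducedQMC T V) π) (hx : (inducedQMC T V).act x = x) :
    x = totalTrace x • π := by
  refine sub_eq_zero.1 (eq_zero_of_inducedQMC_fixed hT hirr V ?_ ?_)
  · rw [BlockOp.act_sub_right, BlockOp.act_smul_right, hx, hπ.1]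
  · rw [totalTrace_sub, totalTrace_smul, hπ.2, mul_one, sub_self]

/-- The column `(-X, X)` is annihilated by the induced chain `Φ`, so it is its own image under
`1 - Φ`. Hence every g-inverse `G` of `1 - Φ` satisfies `(1 - Φ) G (-X, X) = (-X, X)`, that is,
`G (-X, X) - (-X, X)` is a fixed vector of `Φ`. -/
lemma gInverse_act_eq {n : ℕ} {T : SuperOp n} (hT : IsQuantumChannel T)
    (hirr : IsIrreducibleMap T) {V : Submodule ℂ (PureSpace n)} {π : Fin 2 → Mat n}
    (hπ : IsStationaryVec (inducedQMC T V) π) {G : BlockOp n}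
    (hG : IsGInverse (1 - inducedQMC T V) G) (X : Mat n) :
    G.act ![-X, X] = ![-X, X] + totalTrace (G.act ![-X, X]) • π := by
  have h0 : (inducedQMC T V).act ![-X, X] = 0 := by
    funext i
    fin_cases i
    · simpa using inducedQMC_act_zero T V ![-X, X]
    · simpa using inducedQMC_act_one T V ![-X, X]
  have h1 : (1 - inducedQMC T V).act ![-X, X] = ![-X, X] := by
    rw [BlockOp.one_sub_act, h0, sub_zero]
  have h2 : (1 - inducedQMC T V).act (G.act ![-X, X]) = ![-X, X] := by
    have h := congrArg (fun A : BlockOp n => A.act ![-X, X]) (show _ * _ * _ = _ from hG)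
    simp only [BlockOp.act_mul, h1] at h
    exact h
  rw [BlockOp.one_sub_act] at h2
  have h3 : (inducedQMC T V).act (G.act ![-X, X] - ![-X, X]) = G.act ![-X, X] - ![-X, X] := by
    rw [BlockOp.act_sub_right, h0, sub_zero, eq_sub_iff_add_eq, add_comm]
    exact (sub_eq_iff_eq_add.1 h2).symm
  have h4 := eq_totalTrace_smul_of_fixed hT hirr hπ h3
  have h5 : totalTrace ![-X, X] = 0 := by simp [totalTrace]
  rw [totalTrace_sub, h5, sub_zero] at h4
  rw [← h4, add_sub_cancel]

lemma act_neg_self_zero {n : ℕ} (G : BlockOp n) (X : Mat n) :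
    G.act ![-X, X] 0 = G 0 1 X - G 0 0 X := by
  simp [BlockOp.act]; abel

lemma blockDiagPart_mul_apply_zero_one {n : ℕ} (K M : BlockOp n) (X : Mat n) :
    (blockDiagPart K * M) 0 1 X = K 0 0 (M 0 1 X) := by
  rw [blockDiagPart, Matrix.diagonal_mul, Module.End.mul_apply]

lemma blockDiagPart_mul_blockE_zero_one {n : ℕ} (A : BlockOp n) :
    (blockDiagPart A * blockE n) 0 1 = A 0 0 := by
  rw [blockDiagPart, Matrix.diagonal_mul, blockE, mul_one]

/-- The correction terms attached to the stationary vector remove the fixed component left open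
in `gInverse_act_eq`. -/
lemma gInverse_formula_zero_one {n : ℕ} {T : SuperOp n} (hT : IsQuantumChannel T)
    (hirr : IsIrreducibleMap T) {V : Submodule ℂ (PureSpace n)} {π : Fin 2 → Mat n}
    (hπ : IsStationaryVec (inducedQMC T V) π) {G : BlockOp n}
    (hG : IsGInverse (1 - inducedQMC T V) G) (X : Mat n) :
    (ketTrace π * G - blockDiagPart (ketTrace π * G) * blockE n + 1 - G
      + blockDiagPart G * blockE n) 0 1 X = X := by
  have hw := gInverse_act_eq hT hirr hπ hG X
  have h1 := act_neg_self_zero G X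
  have h2 := act_neg_self_zero (ketTrace π * G) X
  rw [BlockOp.act_mul, ketTrace_act] at h2
  have h3 := congrFun hw 0
  rw [h1, Pi.add_apply, h2] at h3
  simp only [Matrix.add_apply, Matrix.sub_apply, blockDiagPart_mul_blockE_zero_one,
    LinearMap.add_apply, LinearMap.sub_apply, Matrix.one_apply_ne (zero_ne_one : (0 : Fin 2) ≠ 1),
    add_zero]
  simp only [Matrix.cons_val_zero] at h3
  rw [sub_add, h3]
  abel

lemma gInverse_formula_zero_one_of_totalTrace_eq_zero {n : ℕ} {T : SuperOp n}
    (hT : IsQuantumChannel T) (hirr : IsIrreducibleMap T) {V : Submodule ℂ (PureSpace n)}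
    {π : Fin 2 → Mat n} (hπ : IsStationaryVec (inducedQMC T V) π) {G : BlockOp n}
    (hG : IsGInverse (1 - inducedQMC T V) G) (X : Mat n)
    (htr : totalTrace (G.act ![-X, X]) = 0) :
    (1 - G + blockDiagPart G * blockE n) 0 1 X = X := by
  have h3 := congrFun (gInverse_act_eq hT hirr hπ hG X) 0
  rw [htr, zero_smul, add_zero, act_neg_self_zero, Matrix.cons_val_zero] at h3
  simp only [Matrix.add_apply, Matrix.sub_apply, blockDiagPart_mul_blockE_zero_one,
    LinearMap.add_apply, LinearMap.sub_apply, Matrix.one_apply_ne (zero_ne_one : (0 : Fin 2) ≠ 1),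
    LinearMap.zero_apply]
  rw [zero_sub, ← sub_eq_neg_add, ← neg_sub, h3, neg_neg]

/-- A kernel vector of `1 - Φ + |u⟩⟨e_I|` has total trace zero, since `Φ` preserves the total
trace, and is therefore a fixed vector of `Φ`. -/
lemma isUnit_one_sub_add_ketTrace {n : ℕ} {T : SuperOp n} (hT : IsQuantumChannel T)
    (hirr : IsIrreducibleMap T) (V : Submodule ℂ (PureSpace n)) {u : Fin 2 → Mat n}
    (hu : totalTrace u ≠ 0) : IsUnit (1 - inducedQMC T V + ketTrace u) := by
  refine BlockOp.isUnit_of_act_eq_zero fun x hx => ?_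
  rw [BlockOp.act_add, BlockOp.one_sub_act, ketTrace_act] at hx
  have h := congrArg totalTrace hx
  rw [totalTrace_add, totalTrace_sub, totalTrace_inducedQMC_act hT, sub_self, zero_add,
    totalTrace_smul, ← zero_smul ℂ (0 : Fin 2 → Mat n), totalTrace_smul, zero_mul] at h
  have hx0 := (mul_eq_zero.1 h).resolve_right hu
  rw [hx0, zero_smul, add_zero] at hx
  exact eq_zero_of_inducedQMC_fixed hT hirr V (sub_eq_zero.1 hx).symm hx0

lemma totalTrace_inverse_act {n : ℕ} {T : SuperOp n} (hT : IsQuantumChannel T)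
    (hirr : IsIrreducibleMap T) (V : Submodule ℂ (PureSpace n)) {u : Fin 2 → Mat n}
    (hu : totalTrace u ≠ 0) (x : Fin 2 → Mat n) :
    totalTrace ((Ring.inverse (1 - inducedQMC T V + ketTrace u)).act x) * totalTrace u =
      totalTrace x := by
  have h := Ring.mul_inverse_cancel _ (isUnit_one_sub_add_ketTrace hT hirr V hu)
  have hx := congrArg (fun A : BlockOp n => totalTrace (A.act x)) h
  simp only [BlockOp.act_mul] at hx
  rw [BlockOp.act_add, BlockOp.one_sub_act, ketTrace_act, totalTrace_add, totalTrace_sub,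
    totalTrace_inducedQMC_act hT, sub_self, zero_add, totalTrace_smul] at hx
  rw [hx, ← actEquiv_apply, map_one, Module.End.one_apply]

lemma isGInverse_inverse_add {n : ℕ} {T : SuperOp n} (hT : IsQuantumChannel T)
    (hirr : IsIrreducibleMap T) (V : Submodule ℂ (PureSpace n)) {u : Fin 2 → Mat n}
    (hu : totalTrace u ≠ 0) (f : Fin 2 → Mat n) :
    IsGInverse (1 - inducedQMC T V)
      (Ring.inverse (1 - inducedQMC T V + ketTrace u) + ketTrace f) := by
  refine BlockOp.ext_act fun x => ?_
  set H := Ring.inverse (1 - inducedQMC T V + ketTrace u) with hH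
  set y := (1 - inducedQMC T V).act x with hy
  have hy0 : totalTrace y = 0 := by
    rw [hy, BlockOp.one_sub_act, totalTrace_sub, totalTrace_inducedQMC_act hT, sub_self]
  have hHy : totalTrace (H.act y) = 0 := by
    have h := totalTrace_inverse_act hT hirr V hu y
    rw [hy0] at h
    exact (mul_eq_zero.1 h).resolve_right hu
  have h := congrArg (fun A : BlockOp n => A.act y)
    (Ring.mul_inverse_cancel _ (isUnit_one_sub_add_ketTrace hT hirr V hu))
  simp only [BlockOp.act_mul] at h
  rw [← hH, BlockOp.act_add, ketTrace_act, hHy, zero_smul, add_zero] at h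
  rw [BlockOp.act_mul, BlockOp.act_mul, ← hy, BlockOp.act_add, ketTrace_act, hy0, zero_smul,
    add_zero, h, ← actEquiv_apply, map_one, Module.End.one_apply]

lemma totalTrace_inverse_add_act {n : ℕ} {T : SuperOp n} (hT : IsQuantumChannel T)
    (hirr : IsIrreducibleMap T) (V : Submodule ℂ (PureSpace n)) {u : Fin 2 → Mat n}
    (hu : totalTrace u ≠ 0) (f : Fin 2 → Mat n) (X : Mat n) :
    totalTrace ((Ring.inverse (1 - inducedQMC T V + ketTrace u) + ketTrace f).act ![-X, X]) =
      0 := by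
  have h5 : totalTrace ![-X, X] = 0 := by simp [totalTrace]
  have h := totalTrace_inverse_act hT hirr V hu ![-X, X]
  rw [h5] at h
  rw [BlockOp.act_add, ketTrace_act, h5, zero_smul, add_zero]
  exact (mul_eq_zero.1 h).resolve_right hu

/-! ### Hitting probability and mean hitting time -/

lemma one_sub_siteProj_mul_inducedQMC_pow {n : ℕ} (T : SuperOp n) (V : Submodule ℂ (PureSpace n))
    (r : ℕ) : ((1 - siteProj n 0) * inducedQMC T V) ^ (r + 1) =
      !![0, 0; (superQ V * T) ^ (r + 1), (superQ V * T) ^ (r + 1)] := by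
  have h1 : (1 - siteProj n 0) * inducedQMC T V = !![0, 0; superQ V * T, superQ V * T] := by
    ext i j : 2
    fin_cases i <;> fin_cases j <;> simp [siteProj, inducedQMC, Matrix.sub_mul]
  induction r with
  | zero => simpa using h1
  | succ r ih =>
    rw [pow_succ', ih, h1, pow_succ' _ (r + 1)]
    ext i j : 2
    fin_cases i <;> fin_cases j <;> simp [Matrix.mul_apply]

lemma monitoredStep_inducedQMC_zero {n : ℕ} (T : SuperOp n) (V : Submodule ℂ (PureSpace n))
    (r : ℕ) (j : Fin 2) :
    monitoredStep (inducedQMC T V) 0 r 0 j = (1 - superQ V) * T * (superQ V * T) ^ r := by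
  cases r with
  | zero => fin_cases j <;> simp [monitoredStep, inducedQMC]
  | succ r =>
    rw [monitoredStep, one_sub_siteProj_mul_inducedQMC_pow]
    fin_cases j <;> simp [inducedQMC, Matrix.mul_apply]

lemma hasSum_opSum {n : ℕ} {a : ℕ → SuperOp n} (ha : ∀ X : Mat n, Summable fun r => a r X)
    (X : Mat n) : HasSum (fun r => a r X) (opSum a X) := by
  set b := Matrix.stdBasis ℂ (Fin n) (Fin n) with hb
  have h1 : ∀ r, a r X = ∑ p, b.equivFun X p • a r (b p) := fun r => by
    conv_lhs => rw [← b.sum_equivFun X]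
    simp only [map_sum, map_smul]
  have h2 : opSum a X = ∑ p, b.equivFun X p • ∑' r, a r (b p) := by
    rw [opSum, ← hb, Module.Basis.constr_apply_fintype]
  rw [h2]
  simp only [h1]
  exact hasSum_sum fun p _ => (ha (b p)).hasSum.const_smul _

lemma hasSum_hittingTimeOp {n : ℕ} {T : SuperOp n} (hT : IsQuantumChannel T)
    (hirr : IsIrreducibleMap T) {V : Submodule ℂ (PureSpace n)} (hV : V ≠ ⊥) (j : Fin 2)
    (X : Mat n) :
    HasSum (fun r : ℕ => ((r + 1 : ℕ) : ℂ) • monitoredStep (inducedQMC T V) 0 r 0 j X)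
      (hittingTimeOp (inducedQMC T V) 0 j X) := by
  refine hasSum_opSum (a := fun r : ℕ =>
    ((r + 1 : ℕ) : ℂ) • monitoredStep (inducedQMC T V) 0 r 0 j) (fun Y => ?_) X
  have h := (summable_smul_pow_superQ_mul hT hirr hV Y).map ((1 - superQ V) * T)
    (LinearMap.continuous_of_finiteDimensional _)
  refine h.congr fun r => ?_
  rw [monitoredStep_inducedQMC_zero, Function.comp_apply, map_smul, LinearMap.smul_apply,
    Module.End.mul_apply ((1 - superQ V) * T)]

/-- Under the trace, `𝒫` may be replaced by the map `1 - 𝒬` of the induced chain, so the entries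
of the monitored steps compute the first visit probabilities. -/
lemma trace_one_sub_superQ_mul {n : ℕ} (T : SuperOp n) (V : Submodule ℂ (PureSpace n)) (r : ℕ)
    (X : Mat n) :
    (((1 - superQ V) * T * (superQ V * T) ^ r) X).trace =
      ((superP V * T * (superQ V * T) ^ r) X).trace := by
  simp only [Module.End.mul_apply, LinearMap.sub_apply, Module.End.one_apply, Matrix.trace_sub,
    trace_superP]

lemma firstVisit_posSemidef {n : ℕ} {T : SuperOp n} (hT : IsQuantumChannel T)
    (V : Submodule ℂ (PureSpace n)) (φ : PureSpace n) (r : ℕ) :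
    ((superP V * T * (superQ V * T) ^ r) (pureState φ)).PosSemidef := by
  rw [Module.End.mul_apply, Module.End.mul_apply]
  exact superP_posSemidef V
    (hT.posSemidef (pow_superQ_mul_posSemidef hT V r (pureState_posSemidef φ)))

lemma firstVisit_re_nonneg {n : ℕ} {T : SuperOp n} (hT : IsQuantumChannel T)
    (V : Submodule ℂ (PureSpace n)) (φ : PureSpace n) (r : ℕ) :
    0 ≤ ((superP V * T * (superQ V * T) ^ r) (pureState φ)).trace.re :=
  (Complex.nonneg_iff.1 (firstVisit_posSemidef hT V φ r).trace_nonneg).1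

/-- Each first visit probability is the difference of two consecutive survival probabilities, and
these tend to zero, so `V` is reached with certainty. -/
lemma hittingProb_eq_one {n : ℕ} {T : SuperOp n} (hT : IsQuantumChannel T)
    (hirr : IsIrreducibleMap T) {V : Submodule ℂ (PureSpace n)} (hV : V ≠ ⊥) {φ : PureSpace n}
    (hnorm : ‖φ‖ = 1) : hittingProb T V φ = 1 := by
  have hdiff : ∀ r, ((superP V * T * (superQ V * T) ^ r) (pureState φ)).trace.re =
      survivalProb T V r φ - survivalProb T V (r + 1) φ := fun r => by
    rw [← trace_one_sub_superQ_mul, survivalProb, survivalProb, pow_succ', Module.End.mul_apply,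
      Module.End.mul_apply, LinearMap.sub_apply, Module.End.one_apply, Matrix.trace_sub, hT.2,
      Complex.sub_re, Module.End.mul_apply, Module.End.mul_apply]
  have hlim : Tendsto (fun r : ℕ => survivalProb T V r φ) atTop (𝓝 0) := by
    have hc : Continuous fun X : Mat n => X.trace.re := by fun_prop
    simpa [Function.comp_def, survivalProb] using (hc.tendsto 0).comp (tendsto_pow_superQ_mul hT hirr hV (pureState φ))
  have hsum : HasSum
      (fun r => ((superP V * T * (superQ V * T) ^ r) (pureState φ)).trace.re) 1 := by
    rw [hasSum_iff_tendsto_nat_of_nonneg (firstVisit_re_nonneg hT V φ)]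
    simp only [hdiff, Finset.sum_range_sub', survivalProb_zero, hnorm]
    simpa using hlim.const_sub 1
  have h := ENNReal.ofReal_tsum_of_nonneg (firstVisit_re_nonneg hT V φ) hsum.summable
  rw [hsum.tsum_eq, ENNReal.ofReal_one] at h
  exact h.symm

/-- The mean hitting time is the trace of the mean hitting time operator at the initial state. -/
lemma meanHittingTime_eq {n : ℕ} {T : SuperOp n} (hT : IsQuantumChannel T)
    (hirr : IsIrreducibleMap T) {V : Submodule ℂ (PureSpace n)} (hV : V ≠ ⊥) {φ : PureSpace n}
    (hnorm : ‖φ‖ = 1) (j : Fin 2) :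
    meanHittingTime T V φ ≠ ∞ ∧ ((meanHittingTime T V φ).toReal : ℂ) =
      (hittingTimeOp (inducedQMC T V) 0 j (pureState φ)).trace := by
  set p : ℕ → ℝ := fun r => ((superP V * T * (superQ V * T) ^ r) (pureState φ)).trace.re
  set t := (hittingTimeOp (inducedQMC T V) 0 j (pureState φ)).trace
  have hp0 : ∀ r, 0 ≤ p r := firstVisit_re_nonneg hT V φ
  have hpc : ∀ r, ((p r : ℝ) : ℂ) =
      ((superP V * T * (superQ V * T) ^ r) (pureState φ)).trace := fun r =>
    Complex.ext rfl (Complex.nonneg_iff.1 (firstVisit_posSemidef hT V φ r).trace_nonneg).2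
  have hsumC : HasSum (fun r : ℕ => ((((r + 1 : ℕ) : ℝ) * p r : ℝ) : ℂ)) t := by
    have h := (hasSum_hittingTimeOp hT hirr hV j (pureState φ)).map
      (Matrix.traceLinearMap (Fin n) ℂ ℂ) (LinearMap.continuous_of_finiteDimensional _)
    convert h using 1
    · funext r
      rw [Function.comp_apply, map_smul, monitoredStep_inducedQMC_zero,
        Matrix.traceLinearMap_apply, trace_one_sub_superQ_mul, ← hpc, smul_eq_mul]
      push_cast
      rfl
    · rfl
  have hsumR : HasSum (fun r : ℕ => ((r + 1 : ℕ) : ℝ) * p r) t.re := Complex.hasSum_re hsumC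
  have hterm : ∀ r : ℕ, 0 ≤ ((r + 1 : ℕ) : ℝ) * p r := fun r =>
    mul_nonneg (Nat.cast_nonneg _) (hp0 r)
  have hτ : meanHittingTime T V φ = ENNReal.ofReal t.re := by
    rw [meanHittingTime, hittingProb_eq_one hT hirr hV hnorm, if_neg (lt_irrefl _),
      ← hsumR.tsum_eq, ENNReal.ofReal_tsum_of_nonneg hterm hsumR.summable]
    refine tsum_congr fun r => ?_
    rw [ENNReal.ofReal_mul (Nat.cast_nonneg _), ENNReal.ofReal_natCast]
    rfl
  refine ⟨hτ ▸ ENNReal.ofReal_ne_top, ?_⟩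
  rw [hτ, ENNReal.toReal_ofReal (hsumR.nonneg hterm)]
  exact (Complex.hasSum_ofReal.2 hsumR).unique hsumC

end

theorem mainTheorem3 {n : ℕ} (T : SuperOp n) (hT : IsQuantumChannel T)
    (hirr : IsIrreducibleMap T) (V : Submodule ℂ (PureSpace n)) (hV : V ≠ ⊥)
    (φ : PureSpace n) (hφ : φ ∈ Vᗮ) (hnorm : ‖φ‖ = 1) :
    (∀ (j : Fin 2) (X : Mat n),
      HasSum (fun r : ℕ => ((r + 1 : ℕ) : ℂ) • monitoredStep (inducedQMC T V) 0 r 0 j X)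
        (hittingTimeOp (inducedQMC T V) 0 j X)) ∧
    (∃! π : Fin 2 → Mat n, IsStationaryVec (inducedQMC T V) π) ∧
    meanHittingTime T V φ ≠ ∞ ∧
    (∀ π : Fin 2 → Mat n, IsStationaryVec (inducedQMC T V) π →
      ∀ G : BlockOp n, IsGInverse (1 - inducedQMC T V) G →
        ((meanHittingTime T V φ).toReal : ℂ) =
          Matrix.trace
            ((blockDiagPart (hittingTimeOp (inducedQMC T V)) *
              (ketTrace π * G - blockDiagPart (ketTrace π * G) * blockE n
                + 1 - G + blockDiagPart G * blockE n)) 0 1 (pureState φ))) ∧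
    (∀ u f : Fin 2 → Mat n, totalTrace u ≠ 0 →
      IsUnit (1 - inducedQMC T V + ketTrace u) ∧
      ∀ G : BlockOp n, G = Ring.inverse (1 - inducedQMC T V + ketTrace u) + ketTrace f →
        IsGInverse (1 - inducedQMC T V) G ∧
        ((meanHittingTime T V φ).toReal : ℂ) =
          Matrix.trace
            ((blockDiagPart (hittingTimeOp (inducedQMC T V)) *
              (1 - G + blockDiagPart G * blockE n)) 0 1 (pureState φ))) := by
  have hn : n ≠ 0 := by
    rintro rfl
    exact hV (Subsingleton.elim _ _)
  have : NeZero n := ⟨hn⟩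
  have hτ := fun j => meanHittingTime_eq hT hirr hV hnorm j
  refine ⟨hasSum_hittingTimeOp hT hirr hV, existsUnique_isStationaryVec hT hirr V, (hτ 0).1,
    fun π hπ G hG => ?_, fun u f hu => ⟨isUnit_one_sub_add_ketTrace hT hirr V hu, ?_⟩⟩
  · rw [(hτ 0).2, blockDiagPart_mul_apply_zero_one, gInverse_formula_zero_one hT hirr hπ hG]
  · rintro G rfl
    obtain ⟨π, hπ, -⟩ := existsUnique_isStationaryVec hT hirr V
    have hG := isGInverse_inverse_add hT hirr V hu f
    refine ⟨hG, ?_⟩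
    rw [(hτ 0).2, blockDiagPart_mul_apply_zero_one,
      gInverse_formula_zero_one_of_totalTrace_eq_zero hT hirr hπ hG _
        (totalTrace_inverse_add_act hT hirr V hu f _)]
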